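/- A nondeterministic one-tape off-line Turing machine has a finite state control and a single semi-infinite tape (squares $0,1,2,\dots$) on which the input is initially written from the leftmost square on, all other squares being blank; in each move it rewrites the scanned square (never writing the blank) and moves its head one square left, one square right, or not at all; it stops in accepting and rejecting states. The time of a computation is its number of moves. The crossing sequence of a computation at a boundary between two adjacent squares is the sequence of states in which the head successively crosses that boundary; the crossing length of a computation is the length of its longest crossing sequence. Under the weak measure, the amount of a resource (time or crossing length) used on an input $x$ is its minimum over all accepting computations on $x$ ($0$ if $x$ is not accepted), and the amount used at length $n$ is the maximum over all inputs of length $n$. Logarithms are in base $2$. Let $L_{AM}$ be the set of all words $a^n$ over the one-letter alphabet $\{a\}$ such that the smallest positive integer that does not divide $n$ (exists and) is a power of $2$; in particular the empty word is not in $L_{AM}$. Theorem. The complement $\{a\}^*\setminus L_{AM}$ is accepted by a nondeterministic one-tape off-line Turing machine which, under the weak measure, works in time $O(n\log\log n)$ and uses crossing sequences of length $O(\log\log n)$. Moreover this complement is not a regular language; hence in the theorem that a language accepted with crossing sequences of length $o(\log\log n)$ under the weak measure is regular, $o(\log\log n)$ cannot be replaced by $O(\log\log n)$. -/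

import Mathlib

/-- Head movements: left, stationary, right. -/
inductive Move where
  | left
  | stay
  | right

/-- A nondeterministic one-tape off-line Turing machine with input alphabet `σ`, nonblank tape
symbols `Γ` and states `Q`.  A tape square contains an element of `Option Γ`, where `none` is the
blank symbol.  A transition writes an element of `Γ`, so the machine never writes the blank. -/
structure OffLineTM (σ Γ Q : Type) where
  /-- the inclusion of the input alphabet in the tape alphabet -/
  input : σ → Γ
  input_injective : Function.Injective input
  /-- the initial state -/
  start : Q
  /-- the accepting states -/
  accept : Set Q
  /-- the rejecting states -/
  reject : Set Q
  disjoint_accept_reject : Disjoint accept reject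
  /-- the possible moves (new state, symbol written, head movement), given the current state and
  the content of the scanned square -/
  δ : Q → Option Γ → Set (Q × Γ × Move)

namespace OffLineTM

variable {σ Γ Q : Type}

/-- Configurations. The squares of the semi-infinite tape are numbered `0, 1, 2, …` -/
structure Cfg (Γ Q : Type) where
  state : Q
  head : ℕ
  tape : ℕ → Option Γ

/-- `MovesTo d i j`: the movement `d` leads the head from square `i` to square `j`. There is no
left move from the leftmost square. -/
def MovesTo : Move → ℕ → ℕ → Prop
  | .left, i, j => i = j + 1
  | .stay, i, j => j = i
  | .right, i, j => j = i + 1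

/-- The initial configuration: the input is written from the leftmost square on, all other squares
are blank, and the head scans the leftmost square. -/
def init (M : OffLineTM σ Γ Q) (x : List σ) : Cfg Γ Q where
  state := M.start
  head := 0
  tape := fun i => (x[i]?).map M.input

/-- One move of the machine. The computation stops in accepting and in rejecting states. -/
def Step (M : OffLineTM σ Γ Q) (c c' : Cfg Γ Q) : Prop :=
  c.state ∉ M.accept ∧ c.state ∉ M.reject ∧
    ∃ (s : Γ) (d : Move), (c'.state, s, d) ∈ M.δ c.state (c.tape c.head) ∧
      c'.tape = Function.update c.tape c.head (some s) ∧ MovesTo d c.head c'.head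

/-- The list `C` of configurations is an accepting computation of `M` on the input `x`. -/
def IsAcceptingComputation (M : OffLineTM σ Γ Q) (x : List σ) (C : List (Cfg Γ Q)) : Prop :=
  C.head? = some (M.init x) ∧ C.IsChain M.Step ∧ ∃ c, C.getLast? = some c ∧ c.state ∈ M.accept

/-- The language accepted by `M`. -/
def language (M : OffLineTM σ Γ Q) : Language σ :=
  {x | ∃ C, M.IsAcceptingComputation x C}

/-- The number of moves of a computation. -/
def time (C : List (Cfg Γ Q)) : ℕ := C.length - 1

open Classical in
/-- The crossing sequence of a computation at the boundary between the squares `b` and `b + 1`: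
the states in which the head crosses this boundary, in either direction. -/
noncomputable def crossingSequence (b : ℕ) : List (Cfg Γ Q) → List Q
  | c :: c' :: C =>
    if (c.head = b ∧ c'.head = b + 1) ∨ (c.head = b + 1 ∧ c'.head = b) then
      c'.state :: crossingSequence b (c' :: C)
    else crossingSequence b (c' :: C)
  | _ => []

/-- The length of the longest crossing sequence of a computation. -/
noncomputable def crossing (C : List (Cfg Γ Q)) : ℕ :=
  ⨆ b : ℕ, (crossingSequence b C).length

theorem length_crossingSequence_le (b : ℕ) (C : List (Cfg Γ Q)) :
    (crossingSequence b C).length ≤ C.length := by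
  fun_induction crossingSequence b C <;> (simp_all; try omega)

/-- The supremum defining `crossing` is that of a bounded family, hence a maximum. -/
theorem bddAbove_crossing (C : List (Cfg Γ Q)) :
    BddAbove (Set.range fun b : ℕ => (crossingSequence b C).length) :=
  ⟨C.length, by rintro _ ⟨b, rfl⟩; exact length_crossingSequence_le b C⟩

/-- The weak measure of the resource `r` on the input `x`: the minimum of `r C` over the accepting
computations `C` on `x`. If `x` is not accepted the value is `0`, since `sInf ∅ = 0` in `ℕ`. -/
noncomputable def weakOn (M : OffLineTM σ Γ Q) (r : List (Cfg Γ Q) → ℕ) (x : List σ) : ℕ :=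
  sInf {k | ∃ C, M.IsAcceptingComputation x C ∧ r C = k}

/-- The weak measure of the resource `r` as a function of the input length: the maximum over all
inputs of length `n`. -/
noncomputable def weak [Fintype σ] (M : OffLineTM σ Γ Q) (r : List (Cfg Γ Q) → ℕ) (n : ℕ) : ℕ :=
  (Finset.univ : Finset (Fin n → σ)).sup fun x => M.weakOn r (List.ofFn x)

end OffLineTM

/-- The unary language of all `aⁿ` such that the smallest positive integer not dividing `n` is a
power of two. The empty word is not in the language, since every positive integer divides `0`. -/
def LAM : Language Unit :=
  {w | ∃ q : ℕ, IsLeast {m : ℕ | 0 < m ∧ ¬ m ∣ w.length} q ∧ ∃ k : ℕ, q = 2 ^ k}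

/-! For `n > 0`, the word `aⁿ` lies outside `LAM` iff there are `k` and `m` with `2 ^ k < m < 2 ^ (k
+ 1)`, `2 ^ k ∣ n` and `¬ m ∣ n` (`notMem_LAM_of_dvd`, `exists_of_notMem_LAM`). When `m` is the
least nondivisor, `n` is divisible by `1, …, 2 ^ k`, so `n ≥ 2 ^ 2 ^ (k - 1)` by a central binomial
estimate (`Nat.two_pow_two_pow_le`), and `k = O(log log n)`.

Such a pair is verified in `k + 1` sweeps with finite memory. The machine guesses `D = 2 ^ (k + 1) -
m` in binary, one digit per sweep, lowest first, and in the first pass guesses which squares reset a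
counter that starts at `D`. Sweep `t` computes digit `t` of the counter at every square; the carry
into the next digit is stored in the square. The last sweep checks that resets occur exactly where
the counter overflows at `2 ^ (k + 1)`, so the distance since the last reset is the position modulo
`m`. Its final value decides `m ∣ n`, and digits of the position, computed likewise, test `2 ^ k ∣
n`. Correctness is `exists_of_accepts_divAutomaton` and `accepts_divAutomaton`; each sweep with its
return costs `O(n)` moves and two crossings per boundary (`Reaches.runs`).

Non-regularity holds because an eventual period can be taken to divide some `n` with `aⁿ ∈ LAM` and
`a²ⁿ ∉ LAM`. -/

/-! ### Binary digits, carries and divisibility by powers of two -/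

theorem Nat.testBit_succ_eq_xor (x t : ℕ) :
    (x + 1).testBit t = (x.testBit t ^^ decide (2 ^ t ∣ x + 1)) := by
  simp only [Nat.testBit_eq_decide_div_mod_eq, Nat.succ_div]
  by_cases h : 2 ^ t ∣ x + 1
  · rcases Nat.mod_two_eq_zero_or_one (x / 2 ^ t) with h' | h' <;> simp [h, h', Nat.add_mod]
  · simp [h]

theorem Nat.two_pow_succ_dvd_iff (y t : ℕ) :
    2 ^ (t + 1) ∣ y ↔ 2 ^ t ∣ y ∧ y.testBit t = false := by
  constructor
  · rintro ⟨u, rfl⟩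
    refine ⟨⟨2 * u, by ring⟩, ?_⟩
    rw [Nat.testBit_eq_decide_div_mod_eq, pow_succ, mul_assoc,
      Nat.mul_div_cancel_left _ (by positivity)]
    simp
  · rintro ⟨⟨u, rfl⟩, h⟩
    rw [Nat.testBit_eq_decide_div_mod_eq, Nat.mul_div_cancel_left _ (by positivity)] at h
    rw [pow_succ]
    apply Nat.mul_dvd_mul_left
    simp at h
    omega

/-- Adding one carries into digit `t + 1` exactly when the carry reaches digit `t` and finds a one
there. This makes one stored carry per square enough to pass from sweep to sweep. -/
theorem Nat.decide_two_pow_succ_dvd_succ (x t : ℕ) :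
    decide (2 ^ (t + 1) ∣ x + 1) = (x.testBit t && decide (2 ^ t ∣ x + 1)) := by
  simp only [Nat.two_pow_succ_dvd_iff, Nat.testBit_succ_eq_xor]
  by_cases h : 2 ^ t ∣ x + 1 <;> simp [h]

theorem Nat.testBit_add_of_two_pow_dvd {t r : ℕ} (D : ℕ) (h : 2 ^ t ∣ r) :
    (D + r).testBit t = (D.testBit t ^^ r.testBit t) := by
  obtain ⟨u, rfl⟩ := h
  simp only [Nat.testBit_eq_decide_div_mod_eq, Nat.add_mul_div_left _ _ (Nat.two_pow_pos t),
    Nat.mul_div_cancel_left _ (Nat.two_pow_pos t)]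
  rcases Nat.mod_two_eq_zero_or_one (D / 2 ^ t) with h | h <;>
    rcases Nat.mod_two_eq_zero_or_one u with h' | h' <;> simp [h, h', Nat.add_mod]

theorem Nat.two_pow_dvd_add_iff_of_mod_eq {t D D' : ℕ} (x : ℕ) (h : D % 2 ^ t = D' % 2 ^ t) :
    2 ^ t ∣ D + x ↔ 2 ^ t ∣ D' + x := by
  simp only [Nat.dvd_iff_mod_eq_zero]
  rw [Nat.add_mod, h, ← Nat.add_mod]

/-! ### Certificates for the complement, and their size -/

/-- A number divisible by `1, …, 2 ^ (k + 1)` is at least `2 ^ 2 ^ k`. -/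
theorem Nat.two_pow_two_pow_le {n k : ℕ} (hn : n ≠ 0) (h : ∀ i, 0 < i → i ≤ 2 ^ (k + 1) → i ∣ n) :
    2 ^ 2 ^ k ≤ n := by
  set N := 2 ^ k with hN
  have hN0 : 0 < N := by positivity
  -- Every prime power dividing the binomial coefficient of `2 * N` over `N` is at most `2 * N`,
  -- hence divides `n`.
  have hC : N.centralBinom ∣ n := by
    rw [Nat.dvd_iff_prime_pow_dvd_dvd]
    intro p j hp hj
    have h1 : j ≤ N.centralBinom.factorization p :=
      (hp.pow_dvd_iff_le_factorization (Nat.centralBinom_ne_zero N)).1 hj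
    apply h _ (pow_pos hp.pos _)
    calc p ^ j ≤ p ^ N.centralBinom.factorization p := Nat.pow_le_pow_right hp.pos h1
      _ ≤ 2 * N := by
        rw [Nat.centralBinom_eq_two_mul_choose]
        exact Nat.pow_factorization_choose_le (by omega)
      _ = 2 ^ (k + 1) := by rw [hN]; ring
  have h4 := Nat.four_pow_le_two_mul_self_mul_centralBinom N hN0
  have hle := Nat.le_of_dvd (Nat.pos_of_ne_zero hn) hC
  -- Absorbs the factor `2 * N` of `4 ^ N ≤ 2 * N * N.centralBinom` at the price of one of the two
  -- factors `2 ^ N`.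
  have h2N : 2 * N ≤ 2 ^ N := by
    obtain ⟨M, hM⟩ : ∃ M, N = M + 1 := ⟨N - 1, by omega⟩
    rw [hM, pow_succ]
    have := @Nat.lt_two_pow_self M
    omega
  have h44 : (4 : ℕ) ^ N = 2 ^ N * 2 ^ N := by
    rw [← mul_pow]; norm_num
  rw [h44] at h4
  have : 2 ^ N * 2 ^ N ≤ 2 ^ N * n := h4.trans (Nat.mul_le_mul h2N hle)
  exact Nat.le_of_mul_le_mul_left this (by positivity)

/-- A least nondivisor `2 ^ j` would satisfy `2 ^ j ≤ m < 2 ^ (k + 1)`, hence divide `2 ^ k` and the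
length. -/
theorem notMem_LAM_of_dvd {w : List Unit} {k m : ℕ} (hkm : 2 ^ k < m) (hmk : m < 2 ^ (k + 1))
    (hk : 2 ^ k ∣ w.length) (hm : ¬ m ∣ w.length) : w ∈ LAMᶜ := by
  rintro ⟨q, ⟨⟨_, hq⟩, hmin⟩, j, rfl⟩
  have h1 : 2 ^ j ≤ m := hmin ⟨by omega, hm⟩
  have h2 : j < k + 1 := (Nat.pow_lt_pow_iff_right (by norm_num)).1 (h1.trans_lt hmk)
  exact hq ((Nat.pow_dvd_pow 2 (by omega)).trans hk)

/-- Here `m` is the least nondivisor and `k` its binary logarithm. Divisibility by all `i ≤ 2 ^ k`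
is more than a certificate needs; it serves to bound `k`. -/
theorem exists_of_notMem_LAM {w : List Unit} (hw : w ∈ LAMᶜ) (h0 : w.length ≠ 0) :
    ∃ k m, 2 ^ k < m ∧ m < 2 ^ (k + 1) ∧ (∀ i, 0 < i → i ≤ 2 ^ k → i ∣ w.length) ∧
      ¬ m ∣ w.length := by
  classical
  have hex : ∃ m, 0 < m ∧ ¬ m ∣ w.length :=
    ⟨w.length + 1, by omega, fun h => by have := Nat.le_of_dvd (by omega) h; omega⟩
  obtain ⟨hpos, hndvd⟩ := Nat.find_spec hex
  set m := Nat.find hex with hm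
  have hmin : ∀ i, 0 < i → i < m → i ∣ w.length := fun i hi him => by
    have := Nat.find_min hex him
    tauto
  have hpow : ∀ k, m ≠ 2 ^ k := fun k hk =>
    hw ⟨m, ⟨⟨hpos, hndvd⟩, fun i hi => Nat.find_min' hex hi⟩, k, hk⟩
  have hle : 2 ^ Nat.log 2 m ≤ m := Nat.pow_log_le_self 2 hpos.ne'
  have hlt := lt_of_le_of_ne hle (hpow _).symm
  exact ⟨Nat.log 2 m, m, hlt, Nat.lt_pow_succ_log_self (by norm_num) m,
    fun i hi hi' => hmin i hi (by omega), hndvd⟩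

/-! ### Non-regularity of the complement -/

/-- By pigeonhole two powers `aⁱ`, `aʲ` lead a finite automaton to the same state; `j - i` is then a
period from `i` on. -/
theorem exists_period_of_isRegular {L : Language Unit} (hL : L.IsRegular) :
    ∃ N P : ℕ, 0 < P ∧ ∀ n, N ≤ n →
      (List.replicate n () ∈ L ↔ List.replicate (n + P) () ∈ L) := by
  obtain ⟨S, _, M, rfl⟩ := hL
  obtain ⟨i, j, hne, hij⟩ :=
    Finite.exists_ne_map_eq_of_infinite fun n : ℕ => M.eval (List.replicate n ())
  wlog hlt : i < j generalizing i j
  · exact this j i hne.symm hij.symm (by omega)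
  refine ⟨i, j - i, by omega, fun n hn => ?_⟩
  have h1 : M.eval (List.replicate n ()) = M.eval (List.replicate (n + (j - i)) ()) := by
    rw [show n = i + (n - i) by omega, show i + (n - i) + (j - i) = j + (n - i) by omega,
      List.replicate_add, List.replicate_add]
    simp only [DFA.eval, DFA.evalFrom_of_append]
    exact congrArg (fun s => M.evalFrom s _) hij
  rw [DFA.mem_accepts, DFA.mem_accepts, h1]

theorem not_isRegular_LAM_compl : ¬ (LAMᶜ).IsRegular := by
  intro hreg
  obtain ⟨N, P, hP, hper⟩ := exists_period_of_isRegular hreg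
  have hper' : ∀ j n, N ≤ n →
      (List.replicate n () ∈ LAMᶜ ↔ List.replicate (n + j * P) () ∈ LAMᶜ) := by
    intro j n hn
    induction j with
    | zero => simp
    | succ j ih => rw [ih, hper _ (by omega), show n + (j + 1) * P = n + j * P + P by ring]
  -- This choice makes `n = 2 ^ k * O` exceed `N` and puts `P` among the numbers below `2 ^ (k +
  -- 1)`, all of which divide `n`. The least nondivisor of `n` is `2 ^ (k + 1)`, since `O` is odd.
  set k := N + P with hk
  set O := ∏ j ∈ (Finset.range (2 ^ (k + 1))).filter Odd, j with hO
  have hOodd : Odd O := Finset.prod_induction _ Odd (fun _ _ => Odd.mul) odd_one (by simp)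
  set n := 2 ^ k * O with hn
  have hdvd : ∀ i, 0 < i → i < 2 ^ (k + 1) → i ∣ n := by
    intro i hi hik
    obtain ⟨a, o, ho, rfl⟩ := Nat.exists_eq_two_pow_mul_odd hi.ne'
    have ho0 := ho.pos
    apply Nat.mul_dvd_mul
    · apply Nat.pow_dvd_pow
      have : 2 ^ a < 2 ^ (k + 1) := lt_of_le_of_lt (Nat.le_mul_of_pos_right _ ho0) hik
      have := (Nat.pow_lt_pow_iff_right (by norm_num)).1 this
      omega
    · refine Finset.dvd_prod_of_mem (fun j => j) (Finset.mem_filter.2 ⟨Finset.mem_range.2 ?_, ho⟩)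
      exact lt_of_le_of_lt (Nat.le_mul_of_pos_left _ (by positivity)) hik
  have hkn : 2 ^ k ≤ n := Nat.le_mul_of_pos_right _ hOodd.pos
  have hklt : k < 2 ^ k := Nat.lt_two_pow_self
  have hnotdvd : ¬ 2 ^ (k + 1) ∣ n := by
    rw [pow_succ, hn, Nat.mul_dvd_mul_iff_left (by positivity), ← even_iff_two_dvd]
    exact Nat.not_even_iff_odd.2 hOodd
  have hin : List.replicate n () ∉ LAMᶜ := by
    intro h
    apply h
    refine ⟨2 ^ (k + 1), ⟨⟨by positivity, by simpa using hnotdvd⟩, ?_⟩, k + 1, rfl⟩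
    rintro i ⟨hi, hi'⟩
    rw [List.length_replicate] at hi'
    by_contra! hlt
    exact hi' (hdvd i hi hlt)
  -- Doubling `n` makes `2 ^ (k + 1)` a divisor, while a Bertrand prime `p` between `2 ^ (k + 1)`
  -- and `2 ^ (k + 2)` exceeds all factors of the product; thus `p` certifies `2 * n`.
  obtain ⟨p, hp, hp1, hp2⟩ := Nat.exists_prime_lt_and_le_two_mul (2 ^ (k + 1)) (by positivity)
  have hp2' : p < 2 ^ (k + 1 + 1) := by
    rw [pow_succ, mul_comm]
    refine lt_of_le_of_ne hp2 ?_
    rintro rfl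
    exact (Nat.not_prime_mul (by norm_num) (by simp)) hp
  have h2k : 2 < p := lt_of_le_of_lt (by rw [pow_succ]; omega) hp1
  have hpn : ¬ p ∣ n + n := by
    rw [← two_mul, hn, hp.dvd_mul, hp.dvd_mul, hO, Prime.dvd_finsetProd_iff hp.prime]
    rintro (h | h | ⟨j, hj, h⟩)
    · exact absurd (Nat.le_of_dvd (by norm_num) h) (by omega)
    · exact absurd (Nat.le_of_dvd (by norm_num) (hp.dvd_of_dvd_pow h)) (by omega)
    · simp only [Finset.mem_filter, Finset.mem_range] at hj
      exact absurd (Nat.le_of_dvd hj.2.pos h) (by omega)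
  have hout : List.replicate (n + n) () ∈ LAMᶜ := by
    refine notMem_LAM_of_dvd hp1 hp2' ?_ (by simpa using hpn)
    rw [List.length_replicate, hn]
    exact ⟨O, by ring⟩
  obtain ⟨j, hj⟩ := hdvd P hP (by rw [pow_succ]; omega)
  have := hper' j n (by omega)
  rw [mul_comm j, ← hj] at this
  exact hin (this.2 hout)

/-! ### Runs with bounds on time and crossings -/

namespace OffLineTM

variable {σ Γ Q : Type}

open Classical in
theorem length_crossingSequence_concat (b : ℕ) (C : List (Cfg Γ Q)) (c c' : Cfg Γ Q)
    (hc : C.getLast? = some c) :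
    (crossingSequence b (C ++ [c'])).length = (crossingSequence b C).length +
      if (c.head = b ∧ c'.head = b + 1) ∨ (c.head = b + 1 ∧ c'.head = b) then 1 else 0 := by
  induction C with
  | nil => simp at hc
  | cons d C ih =>
    cases C with
    | nil =>
      simp only [List.getLast?_singleton, Option.some.injEq] at hc
      subst hc
      simp only [List.cons_append, List.nil_append, crossingSequence]
      split_ifs <;> simp
    | cons e C =>
      rw [List.getLast?_cons_cons] at hc
      have := ih hc
      simp only [List.cons_append, crossingSequence] at this ⊢
      split_ifs at this ⊢ <;> simp_all

/-- `M.Runs c c' T X`: some computation leads from `c` to `c'` in `T` moves and crosses the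
boundary between the squares `b` and `b + 1` at most `X b` times. -/
def Runs (M : OffLineTM σ Γ Q) (c c' : Cfg Γ Q) (T : ℕ) (X : ℕ → ℕ) : Prop :=
  ∃ C : List (Cfg Γ Q), C.head? = some c ∧ C.getLast? = some c' ∧ C.IsChain M.Step ∧
    C.length = T + 1 ∧ ∀ b, (crossingSequence b C).length ≤ X b

theorem Runs.refl (M : OffLineTM σ Γ Q) (c : Cfg Γ Q) : M.Runs c c 0 fun _ => 0 :=
  ⟨[c], rfl, rfl, List.isChain_singleton c, rfl, fun b => by simp [crossingSequence]⟩

theorem Runs.mono {M : OffLineTM σ Γ Q} {c c' : Cfg Γ Q} {T : ℕ} {X X' : ℕ → ℕ}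
    (h : M.Runs c c' T X) (hX : ∀ b, X b ≤ X' b) : M.Runs c c' T X' := by
  obtain ⟨C, h1, h2, h3, h4, h5⟩ := h
  exact ⟨C, h1, h2, h3, h4, fun b => (h5 b).trans (hX b)⟩

theorem Runs.snoc {M : OffLineTM σ Γ Q} {c c' c'' : Cfg Γ Q} {T : ℕ} {X X' : ℕ → ℕ}
    (h : M.Runs c c' T X) (hs : M.Step c' c'')
    (hX : ∀ b, X b + (if (c'.head = b ∧ c''.head = b + 1) ∨ (c'.head = b + 1 ∧ c''.head = b)
      then 1 else 0) ≤ X' b) : M.Runs c c'' (T + 1) X' := by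
  classical
  obtain ⟨C, h1, h2, h3, h4, h5⟩ := h
  refine ⟨C ++ [c''], by cases C <;> simp_all, by simp, ?_, by simp [h4], fun b => ?_⟩
  · rw [List.isChain_append]
    refine ⟨h3, List.isChain_singleton _, ?_⟩
    intro x hx y hy
    rw [h2] at hx
    simp only [Option.mem_def, Option.some.injEq, List.head?_cons] at hx hy
    subst hx hy
    exact hs
  · rw [length_crossingSequence_concat b C c' c'' h2]
    refine le_trans ?_ (hX b)
    have := h5 b
    split_ifs <;> omega

theorem Runs.exists_isAcceptingComputation {M : OffLineTM σ Γ Q} {x : List σ} {c : Cfg Γ Q}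
    {T K : ℕ} (h : M.Runs (M.init x) c T fun _ => K) (hc : c.state ∈ M.accept) :
    ∃ C, M.IsAcceptingComputation x C ∧ time C = T ∧ crossing C ≤ K := by
  obtain ⟨C, h1, h2, h3, h4, h5⟩ := h
  exact ⟨C, ⟨h1, h3, c, h2, hc⟩, by simp [time, h4], ciSup_le h5⟩

/-- A property of configurations that holds initially and is preserved by moves holds at the end
of each accepting computation. -/
theorem IsAcceptingComputation.invariant {M : OffLineTM σ Γ Q} {x : List σ} {C : List (Cfg Γ Q)}
    (hC : M.IsAcceptingComputation x C) {p : Cfg Γ Q → Prop} (h0 : p (M.init x))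
    (hs : ∀ c c', p c → M.Step c c' → p c') : ∃ c, c.state ∈ M.accept ∧ p c := by
  obtain ⟨h1, h2, c, h3, h4⟩ := hC
  refine ⟨c, h4, ?_⟩
  have key : ∀ (C : List (Cfg Γ Q)) (d : Cfg Γ Q), C.head? = some d → p d → C.IsChain M.Step →
      C.getLast? = some c → p c := by
    intro C
    induction C with
    | nil => simp
    | cons e C ih =>
      intro d hd hp hch hl
      simp only [List.head?_cons, Option.some.injEq] at hd
      subst hd
      cases C with
      | nil => simp_all
      | cons f C =>
        rw [List.isChain_cons_cons] at hch
        rw [List.getLast?_cons_cons] at hl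
        exact ih f rfl (hs _ _ hp hch.1) hch.2 hl
  exact key C _ h1 h0 h2 h3

end OffLineTM

/-! ### Sweep automata and their simulation by Turing machines -/

/-- A finite transducer which is swept repeatedly from left to right over a word with letters in
`A`, rewriting the letters. -/
structure SweepAutomaton (A S : Type) where
  /-- the letters of which the first word may consist -/
  letters : Set A
  /-- the states in which the first sweep may begin -/
  start : Set S
  /-- the possible moves (new state, new letter) -/
  step : S → A → Set (S × A)
  /-- the states in which a sweep may begin, given the state in which the preceding one ended -/
  turn : S → Set S
  /-- the accepting states, at the end of a sweep -/
  accept : Set S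

namespace SweepAutomaton

variable {A S : Type}

/-- `V.Reaches n t h s w`: on words of length `n`, after `t` complete sweeps and `h` letters of the
next one, the automaton can be in state `s` with the word `w`. -/
inductive Reaches (V : SweepAutomaton A S) (n : ℕ) : ℕ → ℕ → S → (ℕ → A) → Prop
  | start {s w} : s ∈ V.start → (∀ i, w i ∈ V.letters) → Reaches V n 0 0 s w
  | step {t h s w s' a} : Reaches V n t h s w → h < n → (s', a) ∈ V.step s (w h) →
      Reaches V n t (h + 1) s' (Function.update w h a)
  | turn {t s w s'} : Reaches V n t n s w → s' ∈ V.turn s → Reaches V n (t + 1) 0 s' w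

/-- The automaton accepts words of length `n` after `t` complete sweeps and one more. -/
def Accepts (V : SweepAutomaton A S) (n t : ℕ) : Prop :=
  ∃ s w, V.Reaches n t n s w ∧ s ∈ V.accept

/-- Tape symbols of the Turing machine: the input letter, letters of the automaton (marked in the
leftmost square) and a right end marker. -/
inductive Symbol (A : Type) where
  | input
  | letter (leftmost : Bool) (a : A)
  | endMark

/-- States of the Turing machine. -/
inductive State (S : Type) where
  | start
  | fill
  | left (s : S)
  | right (s : S)
  | accept

instance [Finite A] : Finite (Symbol A) :=
  Finite.of_surjective (fun x : Option (Option (Bool × A)) => match x with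
    | none => Symbol.input
    | some none => Symbol.endMark
    | some (some (f, a)) => Symbol.letter f a) fun y => by
      cases y with
      | input => exact ⟨none, rfl⟩
      | letter f a => exact ⟨some (some (f, a)), rfl⟩
      | endMark => exact ⟨some none, rfl⟩

instance [Finite S] : Finite (State S) :=
  Finite.of_surjective (fun x : Option (Option (Option (S ⊕ S))) => match x with
    | none => State.start
    | some none => State.fill
    | some (some none) => State.accept
    | some (some (some (.inl s))) => State.left s
    | some (some (some (.inr s))) => State.right s) fun y => by
      cases y with
      | start => exact ⟨none, rfl⟩
      | fill => exact ⟨some none, rfl⟩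
      | accept => exact ⟨some (some none), rfl⟩
      | left s => exact ⟨some (some (some (.inl s))), rfl⟩
      | right s => exact ⟨some (some (some (.inr s))), rfl⟩

/-- The moves of the Turing machine which simulates the automaton. -/
inductive Trans (V : SweepAutomaton A S) :
    State S → Option (Symbol A) → State S × Symbol A × Move → Prop
  | empty : Trans V .start none (.accept, .endMark, .stay)
  | first {a} : a ∈ V.letters → Trans V .start (some .input) (.fill, .letter true a, .right)
  | fill {a} : a ∈ V.letters → Trans V .fill (some .input) (.fill, .letter false a, .right)
  | filled {s} : s ∈ V.start → Trans V .fill none (.left s, .endMark, .left)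
  | back {s a} : Trans V (.left s) (some (.letter false a)) (.left s, .letter false a, .left)
  | leftEnd {s a} : Trans V (.left s) (some (.letter true a)) (.right s, .letter true a, .stay)
  | step {s a s' a' f} : (s', a') ∈ V.step s a →
      Trans V (.right s) (some (.letter f a)) (.right s', .letter f a', .right)
  | turn {s s'} : s' ∈ V.turn s → Trans V (.right s) (some .endMark) (.left s', .endMark, .left)
  | accept {s} : s ∈ V.accept → Trans V (.right s) (some .endMark) (.accept, .endMark, .stay)

/-- The Turing machine which simulates the automaton; it accepts the empty word. -/
def toTM (V : SweepAutomaton A S) : OffLineTM Unit (Symbol A) (State S) where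
  input _ := .input
  input_injective _ _ _ := rfl
  start := .start
  accept := {.accept}
  reject := ∅
  disjoint_accept_reject := by simp
  δ q x := {r | V.Trans q x r}

/-- The tape with the word `w` of length `n`. -/
def wordTape (n : ℕ) (w : ℕ → A) (i : ℕ) : Option (Symbol A) :=
  if i < n then some (.letter (decide (i = 0)) (w i)) else if i = n then some .endMark else none

/-- The tape on which the first `h` input letters have been replaced by those of `w`. -/
def fillTape (n h : ℕ) (w : ℕ → A) (i : ℕ) : Option (Symbol A) :=
  if i < h then some (.letter (decide (i = 0)) (w i)) else if i < n then some .input else none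

theorem update_wordTape {n h : ℕ} (w : ℕ → A) (a : A) (hh : h < n) :
    Function.update (wordTape n w) h (some (.letter (decide (h = 0)) a)) =
      wordTape n (Function.update w h a) := by
  funext i
  by_cases hi : i = h
  · subst hi; simp [wordTape, hh]
  · simp [wordTape, hi]

theorem update_wordTape_self {n h : ℕ} (w : ℕ → A) :
    Function.update (wordTape n w) h (wordTape n w h) = wordTape n w := by simp

theorem update_fillTape {n h : ℕ} (w : ℕ → A) (a : A) :
    Function.update (fillTape n h w) h (some (.letter (decide (h = 0)) a)) =
      fillTape n (h + 1) (Function.update w h a) := by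
  funext i
  by_cases hi : i = h
  · subst hi; simp [fillTape]
  · have : i < h + 1 ↔ i < h := by omega
    simp [fillTape, hi, this]

theorem update_fillTape_endMark {n : ℕ} (w : ℕ → A) :
    Function.update (fillTape n n w) n (some .endMark) = wordTape n w := by
  funext i
  by_cases hi : i = n
  · subst hi; simp [wordTape]
  · by_cases h : i < n <;> simp [fillTape, wordTape, hi, h]

theorem init_toTM (V : SweepAutomaton A S) (x : List Unit) (w : ℕ → A) :
    V.toTM.init x = ⟨.start, 0, fillTape x.length 0 w⟩ := by
  simp only [OffLineTM.init, toTM, OffLineTM.Cfg.mk.injEq, true_and]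
  funext i
  by_cases hi : i < x.length <;> simp [fillTape, hi]

/-- What can be said about the configurations that occur on an input of length `n`. -/
def Inv (V : SweepAutomaton A S) (n : ℕ) (c : OffLineTM.Cfg (Symbol A) (State S)) : Prop :=
  match c.state with
  | .start => c.head = 0 ∧ ∃ w, c.tape = fillTape n 0 w
  | .fill => 0 < c.head ∧ c.head ≤ n ∧ ∃ w, (∀ i, w i ∈ V.letters) ∧ c.tape = fillTape n c.head w
  | .left s => c.head < n ∧ ∃ t w, V.Reaches n t 0 s w ∧ c.tape = wordTape n w
  | .right s => c.head ≤ n ∧ ∃ t w, V.Reaches n t c.head s w ∧ c.tape = wordTape n w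
  | .accept => n = 0 ∨ ∃ t, V.Accepts n t

theorem Inv.step {V : SweepAutomaton A S} {n : ℕ} {c c' : OffLineTM.Cfg (Symbol A) (State S)}
    (hc : V.Inv n c) (hs : V.toTM.Step c c') : V.Inv n c' := by
  obtain ⟨q, h, T⟩ := c
  obtain ⟨q', h', T'⟩ := c'
  obtain ⟨-, -, a, d, htr, hT, hmv⟩ := hs
  change V.Trans q (T h) (q', a, d) at htr
  dsimp only at hT hmv
  generalize hx : T h = x at htr
  cases htr with
  | empty =>
    obtain ⟨rfl, w, rfl⟩ : h = 0 ∧ ∃ w, T = fillTape n 0 w := hc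
    left
    by_contra h0
    simp [fillTape, Nat.pos_of_ne_zero h0] at hx
  | @first a ha =>
    obtain ⟨rfl, w, rfl⟩ : h = 0 ∧ ∃ w, T = fillTape n 0 w := hc
    obtain rfl : h' = 0 + 1 := hmv
    have hn : 0 < n := by
      by_contra h0
      simp [fillTape, h0] at hx
    -- Only the value at square `0` is on the tape so far; a constant word keeps the remaining
    -- values among the admissible letters.
    refine ⟨Nat.one_pos, hn, fun _ => a, fun _ => ha, hT.trans ?_⟩
    rw [show (true : Bool) = decide (0 = 0) by simp, update_fillTape]
    funext i
    by_cases hi : i < 1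
    · obtain rfl : i = 0 := by omega
      simp [fillTape]
    · simp [fillTape, hi]
  | @fill a ha =>
    obtain ⟨h0, hn, w, hw, rfl⟩ : 0 < h ∧ h ≤ n ∧ ∃ w : ℕ → A, (∀ i, w i ∈ V.letters) ∧
      T = fillTape n h w := hc
    obtain rfl : h' = h + 1 := hmv
    have hn : h < n := by
      by_contra h0
      simp [fillTape, h0] at hx
    refine ⟨Nat.succ_pos _, hn, Function.update w h a, fun i => ?_, hT.trans ?_⟩
    · by_cases hi : i = h
      · subst hi; simpa using ha
      · simpa [hi] using hw i
    · rw [← update_fillTape]; simp [h0.ne']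
  | @filled s hs =>
    obtain ⟨h0, hn, w, hw, rfl⟩ : 0 < h ∧ h ≤ n ∧ ∃ w : ℕ → A, (∀ i, w i ∈ V.letters) ∧
      T = fillTape n h w := hc
    obtain rfl : h = h' + 1 := hmv
    obtain rfl : h' + 1 = n := by
      by_contra h1
      have : h' + 1 < n := by omega
      simp [fillTape, this] at hx
    exact ⟨Nat.lt_succ_self _, 0, w, .start hs hw, hT.trans (update_fillTape_endMark w)⟩
  | @back s a =>
    obtain ⟨h0, t, w, hw, rfl⟩ : h < n ∧ ∃ t w, V.Reaches n t 0 s w ∧ T = wordTape n w := hc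
    obtain rfl : h = h' + 1 := hmv
    exact ⟨by change h' < n; omega, t, w, hw, by rw [hT, ← hx, update_wordTape_self]⟩
  | @leftEnd s a =>
    obtain ⟨h0, t, w, hw, rfl⟩ : h < n ∧ ∃ t w, V.Reaches n t 0 s w ∧ T = wordTape n w := hc
    obtain rfl : h' = h := hmv
    obtain rfl : h' = 0 := by
      simp only [wordTape, h0, if_true, Option.some.injEq, Symbol.letter.injEq] at hx
      simpa using hx.1
    exact ⟨h0.le, t, w, hw, by rw [hT, ← hx, update_wordTape_self]⟩
  | @step s a s' a' f hs =>
    obtain ⟨h0, t, w, hw, rfl⟩ : h ≤ n ∧ ∃ t w, V.Reaches n t h s w ∧ T = wordTape n w := hc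
    obtain rfl : h' = h + 1 := hmv
    have hn : h < n := by
      by_contra h1
      obtain rfl : h = n := by omega
      simp [wordTape] at hx
    simp only [wordTape, hn, if_true, Option.some.injEq, Symbol.letter.injEq] at hx
    obtain ⟨rfl, rfl⟩ := hx
    exact ⟨hn, t, _, hw.step hn hs, hT.trans (update_wordTape w a' hn)⟩
  | @turn s s' hs =>
    obtain ⟨h0, t, w, hw, rfl⟩ : h ≤ n ∧ ∃ t w, V.Reaches n t h s w ∧ T = wordTape n w := hc
    obtain rfl : h = h' + 1 := hmv
    obtain rfl : h' + 1 = n := by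
      by_contra h1
      have : h' + 1 < n := by omega
      simp [wordTape, this] at hx
    exact ⟨Nat.lt_succ_self _, t + 1, w, hw.turn hs, by rw [hT, ← hx, update_wordTape_self]⟩
  | @accept s hs =>
    obtain ⟨h0, t, w, hw, rfl⟩ : h ≤ n ∧ ∃ t w, V.Reaches n t h s w ∧ T = wordTape n w := hc
    obtain rfl : h = n := by
      by_contra h1
      have : h < n := by omega
      simp [wordTape, this] at hx
    exact Or.inr ⟨t, s, w, hw, hs⟩

theorem accepts_of_mem_language [Nonempty A] {V : SweepAutomaton A S} {x : List Unit}
    (hx : x ∈ V.toTM.language) : x.length = 0 ∨ ∃ t, V.Accepts x.length t := by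
  obtain ⟨C, hC⟩ := hx
  have h0 : V.Inv x.length (V.toTM.init x) :=
    ⟨rfl, fun _ => Classical.arbitrary A, by rw [V.init_toTM x fun _ => Classical.arbitrary A]⟩
  obtain ⟨⟨q, h, T⟩, hacc, hinv⟩ := hC.invariant h0 fun c c' => Inv.step
  obtain rfl : q = .accept := hacc
  exact hinv

theorem toTM_step {V : SweepAutomaton A S} {q q' : State S} {h h' : ℕ}
    {T T' : ℕ → Option (Symbol A)} {a : Symbol A} {d : Move} (htr : V.Trans q (T h) (q', a, d))
    (hT : T' = Function.update T h (some a)) (hmv : OffLineTM.MovesTo d h h') :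
    V.toTM.Step ⟨q, h, T⟩ ⟨q', h', T'⟩ := by
  refine ⟨?_, Set.notMem_empty _, a, d, htr, hT, hmv⟩
  rintro rfl
  change V.Trans .accept _ _ at htr
  cases htr

/-- The run on the input of length `n` that writes the word `w` as far as the square `h`. -/
theorem runs_fill {V : SweepAutomaton A S} {x : List Unit} {w : ℕ → A}
    (hw : ∀ i, w i ∈ V.letters) (h : ℕ) (hh : h < x.length) :
    V.toTM.Runs (V.toTM.init x) ⟨.fill, h + 1, fillTape x.length (h + 1) w⟩ (h + 1)
      fun b => if b < h + 1 then 1 else 0 := by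
  have hupd : ∀ h, fillTape x.length (h + 1) w =
      Function.update (fillTape x.length h w) h (some (.letter (decide (h = 0)) (w h))) := by
    intro h
    rw [update_fillTape, Function.update_eq_self]
  induction h with
  | zero =>
    refine (OffLineTM.Runs.refl _ _).snoc ?_ fun b => ?_
    · rw [V.init_toTM x w]
      refine toTM_step (a := .letter true (w 0)) (d := .right) ?_ (hupd 0) rfl
      simp only [fillTape, Nat.not_lt_zero, if_false, hh, if_true]
      exact .first (hw 0)
    · rw [V.init_toTM x w]; rcases b with _ | b <;> simp
  | succ h ih =>
    refine (ih (by omega)).snoc (toTM_step (a := .letter false (w (h + 1))) (d := .right) ?_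
      (hupd (h + 1)) rfl) fun b => ?_
    · simp only [fillTape, lt_irrefl, if_false, hh, if_true]
      exact .fill (hw _)
    · dsimp only; split_ifs <;> omega

/-- The return to the leftmost square. -/
theorem runs_left {V : SweepAutomaton A S} {c : OffLineTM.Cfg (Symbol A) (State S)} {n : ℕ}
    {s : S} {w : ℕ → A} (h : ℕ) {T : ℕ} {X : ℕ → ℕ} (hn : h < n)
    (hr : V.toTM.Runs c ⟨.left s, h, wordTape n w⟩ T X) :
    V.toTM.Runs c ⟨.right s, 0, wordTape n w⟩ (T + h + 1)
      fun b => X b + if b < h then 1 else 0 := by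
  induction h generalizing T X with
  | zero =>
    refine hr.snoc (toTM_step (a := .letter true (w 0)) (d := .stay) ?_ ?_ rfl) fun b => ?_
    · simp only [wordTape, hn, if_true, decide_true]
      exact .leftEnd
    · rw [show (true : Bool) = decide (0 = 0) by simp, update_wordTape _ _ hn,
        Function.update_eq_self]
    · simp
  | succ h ih =>
    have := hr.snoc (c'' := ⟨.left s, h, wordTape n w⟩)
      (X' := fun b => X b + if b = h then 1 else 0)
      (toTM_step (a := .letter false (w (h + 1))) (d := .left) ?_ ?_ rfl) fun b => ?_
    · have := ih (by omega) this
      rw [show T + (h + 1) + 1 = T + 1 + h + 1 by ring]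
      refine this.mono fun b => ?_
      split_ifs <;> omega
    · simp only [wordTape, hn, if_true, Nat.succ_ne_zero, decide_false]
      exact .back
    · rw [show (false : Bool) = decide (h + 1 = 0) by simp, update_wordTape _ _ hn,
        Function.update_eq_self]
    · dsimp only; split_ifs <;> omega

/-- Filling the tape takes `n` moves and returning takes `n + 1`: one off the end marker, `n - 1` to
the leftmost square, and a stationary one there. A sweep and its return cost the same, and each such
round trip crosses every boundary left of the end marker twice. Hence the factor `t + 1` for filling
plus `t` sweeps. -/
theorem Reaches.runs {V : SweepAutomaton A S} {x : List Unit} (hx : x.length ≠ 0) {t h : ℕ} {s : S}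
    {w : ℕ → A} (hr : V.Reaches x.length t h s w) :
    V.toTM.Runs (V.toTM.init x) ⟨.right s, h, wordTape x.length w⟩
      ((2 * x.length + 1) * (t + 1) + h) fun b => 2 * (t + 1) + if b < h then 1 else 0 := by
  generalize hn : x.length = n at hr hx
  obtain ⟨m, rfl⟩ := Nat.exists_eq_succ_of_ne_zero hx
  have h_end : ∀ w : ℕ → A, wordTape (m + 1) w =
      Function.update (wordTape (m + 1) w) (m + 1) (some .endMark) := by
    intro w
    rw [eq_comm, Function.update_eq_iff]
    simp [wordTape]
  induction hr with
  | @start s w hs hw =>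
    have h1 := runs_fill (x := x) hw m (by omega)
    rw [hn] at h1
    have h2 := h1.snoc (c'' := ⟨.left s, m, wordTape (m + 1) w⟩) (X' := fun b =>
      (if b < m + 1 then 1 else 0) + if b = m then 1 else 0)
      (toTM_step (a := .endMark) (d := .left) ?_ (update_fillTape_endMark w).symm rfl) fun b => ?_
    · have h3 := runs_left m (Nat.lt_succ_self m) h2
      rw [show (2 * (m + 1) + 1) * (0 + 1) + 0 = m + 1 + 1 + m + 1 by ring]
      refine h3.mono fun b => ?_
      split_ifs <;> omega
    · simp only [fillTape, lt_irrefl, if_false]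
      exact .filled hs
    · dsimp only; split_ifs <;> omega
  | @step t h s w s' a hr hh hs ih =>
    refine ih.snoc (toTM_step (a := .letter (decide (h = 0)) a) (d := .right) ?_
      (update_wordTape w a hh).symm rfl) fun b => ?_
    · simp only [wordTape, hh, if_true]
      exact .step hs
    · dsimp only; split_ifs <;> omega
  | @turn t s w s' hr hs ih =>
    have h2 := ih.snoc (c'' := ⟨.left s', m, wordTape (m + 1) w⟩) (X' := fun b =>
      2 * (t + 1) + (if b < m + 1 then 1 else 0) + if b = m then 1 else 0)
      (toTM_step (a := .endMark) (d := .left) ?_ (h_end w) rfl) fun b => ?_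
    · have h3 := runs_left m (Nat.lt_succ_self m) h2
      rw [show (2 * (m + 1) + 1) * (t + 1 + 1) + 0 =
        (2 * (m + 1) + 1) * (t + 1) + (m + 1) + 1 + m + 1 by ring]
      refine h3.mono fun b => ?_
      split_ifs <;> omega
    · simp only [wordTape, lt_irrefl, if_false, if_true]
      exact .turn hs
    · dsimp only; split_ifs <;> omega

theorem Accepts.exists_isAcceptingComputation {V : SweepAutomaton A S} {x : List Unit}
    (hx : x.length ≠ 0) {t : ℕ} (h : V.Accepts x.length t) :
    ∃ C, V.toTM.IsAcceptingComputation x C ∧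
      OffLineTM.time C = (2 * x.length + 1) * (t + 1) + x.length + 1 ∧
      OffLineTM.crossing C ≤ 2 * (t + 1) + 1 := by
  obtain ⟨s, w, hr, hs⟩ := h
  have h1 := (hr.runs hx).snoc (c'' := ⟨.accept, x.length,
    Function.update (wordTape x.length w) x.length (some .endMark)⟩) (X' := fun _ => 2 * (t + 1) + 1)
    (toTM_step (a := .endMark) (d := .stay) ?_ rfl rfl) fun b => ?_
  · exact h1.exists_isAcceptingComputation rfl
  · simp only [wordTape, lt_irrefl, if_false, if_true]
    exact .accept hs
  · dsimp only; split_ifs <;> omega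

theorem mem_language_of_length_eq_zero (V : SweepAutomaton A S) {x : List Unit}
    (hx : x.length = 0) : x ∈ V.toTM.language := by
  obtain rfl := List.length_eq_zero_iff.1 hx
  have h1 := (OffLineTM.Runs.refl V.toTM (V.toTM.init [])).snoc (c'' := ⟨.accept, 0,
    Function.update (V.toTM.init []).tape 0 (some .endMark)⟩) (X' := fun _ => 0)
    (toTM_step (a := .endMark) (d := .stay) .empty rfl rfl) fun b => ?_
  · obtain ⟨C, hC, -⟩ := h1.exists_isAcceptingComputation rfl
    exact ⟨C, hC⟩
  · simp [OffLineTM.init]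

theorem mem_language_toTM [Nonempty A] {V : SweepAutomaton A S} {x : List Unit} :
    x ∈ V.toTM.language ↔ x.length = 0 ∨ ∃ t, V.Accepts x.length t := by
  refine ⟨accepts_of_mem_language, fun h => ?_⟩
  by_cases hx : x.length = 0
  · exact V.mem_language_of_length_eq_zero hx
  · obtain ⟨t, ht⟩ := h.resolve_left hx
    obtain ⟨C, hC, -⟩ := ht.exists_isAcceptingComputation hx
    exact ⟨C, hC⟩

end SweepAutomaton

/-! ### The automaton that counts modulo a guessed number -/

/-- A letter of `divAutomaton` in a square `i`: after `t` sweeps, `carry` and `dvd` tell whether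
`2 ^ t` divides `D + r + 1` and `i + 1`, where `r` is the number of squares between the last
preceding `reset` (or the left end of the word) and `i`. -/
structure DivLetter where
  reset : Bool
  carry : Bool
  dvd : Bool

/-- A state of `divAutomaton` in the sweep number `t`, before a square `i`: `bit` is the `t`-th
binary digit of `D`, `nonzero` tells whether there is a nonzero digit before it, `rem` whether `2 ^ t`
fails to divide the number of squares after the last reset in the word, and `index` and `count` are
the `t`-th digits of `i` and of `D + r`, where `r` is as for `DivLetter`. -/
structure DivState where
  last : Bool
  bit : Bool
  nonzero : Bool
  rem : Bool
  index : Bool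
  count : Bool

instance : Nonempty DivLetter := ⟨⟨true, true, true⟩⟩

instance : Finite DivLetter :=
  Finite.of_injective (fun a => (a.reset, a.carry, a.dvd)) <| by
    rintro ⟨⟩ ⟨⟩ h; simpa using h

instance : Finite DivState :=
  Finite.of_injective (fun s => (s.last, s.bit, s.nonzero, s.rem, s.index, s.count)) <| by
    rintro ⟨⟩ ⟨⟩ h; simpa using h

/-- The letter that replaces `a`. -/
def DivState.output (s : DivState) (a : DivLetter) : DivLetter :=
  ⟨a.reset, s.count && a.carry, s.index && a.dvd⟩

/-- The state after reading `a`. -/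
def DivState.next (s : DivState) (a : DivLetter) : DivState :=
  { s with
    index := s.index ^^ a.dvd
    count := if a.reset then s.bit else s.count ^^ a.carry }

/-- The automaton guesses the binary digits of a number `D` and guesses resets. Under the conditions
checked in `step`, these must take place in the squares `i` for which `2 ^ (k + 1) - D` divides
`i + 1`, where `k` is the number of sweeps before the last one. -/
def divAutomaton : SweepAutomaton DivLetter DivState where
  letters := {a | a.carry ∧ a.dvd}
  start := {s | ∃ l d, s = ⟨l, d, false, false, false, d⟩ ∧ (l → d = false)}
  step s a := {r | r = (s.next a, s.output a) ∧ (a.reset → (s.output a).carry) ∧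
    (s.last → ¬ a.reset → ¬ (s.output a).carry)}
  turn s := {s' | s.last = false ∧ s.index = false ∧ ∃ l d,
    s' = ⟨l, d, s.nonzero || s.bit, s.rem || (s.count ^^ s.bit), false, d⟩ ∧ (l → d = false)}
  accept := {s | s.last ∧ s.nonzero ∧ (s.rem || (s.count ^^ s.bit))}

/-- The number of squares between the last reset before the square `i` and `i`. -/
def sinceReset (R : ℕ → Bool) : ℕ → ℕ
  | 0 => 0
  | i + 1 => if R i then 0 else sinceReset R i + 1

/-- The letter in the square `i` after `t` sweeps. -/
def divLetter (D : ℕ) (R : ℕ → Bool) (t i : ℕ) : DivLetter :=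
  ⟨R i, decide (2 ^ t ∣ D + sinceReset R i + 1), decide (2 ^ t ∣ i + 1)⟩

/-- The word after `t` sweeps and `h` further letters. -/
def divWord (D : ℕ) (R : ℕ → Bool) (t h i : ℕ) : DivLetter :=
  if i < h then divLetter D R (t + 1) i else divLetter D R t i

/-- The state after `t` sweeps over a word of length `n` and `h` further letters. -/
def divState (n D : ℕ) (R : ℕ → Bool) (l : Bool) (t h : ℕ) : DivState :=
  ⟨l, D.testBit t, decide (D % 2 ^ t ≠ 0), decide (¬ 2 ^ t ∣ sinceReset R n), h.testBit t,
    (D + sinceReset R h).testBit t⟩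

theorem update_divWord (D : ℕ) (R : ℕ → Bool) (t h : ℕ) :
    Function.update (divWord D R t h) h (divLetter D R (t + 1) h) = divWord D R t (h + 1) := by
  funext i
  by_cases hi : i = h
  · subst hi; simp [divWord]
  · have : i < h + 1 ↔ i < h := by omega
    simp [divWord, hi, this]

theorem output_divState (n D : ℕ) (R : ℕ → Bool) (l : Bool) (t h : ℕ) :
    (divState n D R l t h).output (divLetter D R t h) = divLetter D R (t + 1) h := by
  simp only [DivState.output, divState, divLetter, Nat.decide_two_pow_succ_dvd_succ]

/-- After a reset the counter is `D` again, whose digit `t` is the guessed `bit`; otherwise it grows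
by one and the digit flips iff the stored carry is set. -/
theorem next_divState (n D : ℕ) (R : ℕ → Bool) (l : Bool) (t h : ℕ) :
    (divState n D R l t h).next (divLetter D R t h) = divState n D R l t (h + 1) := by
  simp only [DivState.next, divState, divLetter, Nat.testBit_succ_eq_xor, DivState.mk.injEq,
    true_and, sinceReset]
  by_cases hR : R h
  · simp [hR]
  · simp [hR, ← add_assoc, Nat.testBit_succ_eq_xor]

/-- If `2 ^ t ∣ r`, adding `r` to `D` brings no carry into digit `t`, so digit `t` of `r` is the xor
of those of `D + r` and `D`. Thus `r` is tested for zero digit by digit although only `D + r` is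
tracked. -/
theorem decide_not_two_pow_succ_dvd (D r t : ℕ) :
    (decide (¬ 2 ^ t ∣ r) || ((D + r).testBit t ^^ D.testBit t)) =
      decide (¬ 2 ^ (t + 1) ∣ r) := by
  by_cases h : 2 ^ t ∣ r
  · simp [h, Nat.testBit_add_of_two_pow_dvd, Nat.two_pow_succ_dvd_iff]
    cases D.testBit t <;> cases r.testBit t <;> rfl
  · simp [h, Nat.two_pow_succ_dvd_iff]

theorem decide_mod_two_pow_succ_ne_zero (D t : ℕ) :
    (decide (D % 2 ^ t ≠ 0) || D.testBit t) = decide (D % 2 ^ (t + 1) ≠ 0) := by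
  have h := Nat.two_pow_succ_dvd_iff D t
  rw [Nat.dvd_iff_mod_eq_zero, Nat.dvd_iff_mod_eq_zero] at h
  rw [Bool.eq_iff_iff]
  simp only [Bool.or_eq_true, decide_eq_true_eq, ne_eq, h]
  cases D.testBit t <;> simp

/-- The conditions checked in the first `h` squares after `t` sweeps. -/
def ResetsValid (D : ℕ) (R : ℕ → Bool) (l : Bool) (t h : ℕ) : Prop :=
  ∀ i < h, (R i → 2 ^ (t + 1) ∣ D + sinceReset R i + 1) ∧
    (l → ¬ R i → ¬ 2 ^ (t + 1) ∣ D + sinceReset R i + 1)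

theorem update_eq_divWord {n D : ℕ} {R : ℕ → Bool} {t h : ℕ} {w : ℕ → DivLetter}
    (hw : ∀ i < n, w i = divWord D R t h i) :
    ∀ i < n, Function.update w h (divLetter D R (t + 1) h) i = divWord D R t (h + 1) i := by
  intro i hi
  rw [← update_divWord]
  by_cases hih : i = h
  · simp [hih]
  · simp [hih, hw i hi]

theorem mem_step_divAutomaton {n D : ℕ} {R : ℕ → Bool} {l : Bool} {t h : ℕ} {s : DivState}
    {a : DivLetter} :
    (s, a) ∈ divAutomaton.step (divState n D R l t h) (divWord D R t h h) ↔
      s = divState n D R l t (h + 1) ∧ a = divLetter D R (t + 1) h ∧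
      (R h → 2 ^ (t + 1) ∣ D + sinceReset R h + 1) ∧
      (l → ¬ R h → ¬ 2 ^ (t + 1) ∣ D + sinceReset R h + 1) := by
  have : divWord D R t h h = divLetter D R t h := by simp [divWord]
  rw [this]
  simp only [divAutomaton, Set.mem_ofPred_eq, output_divState, next_divState, Prod.mk.injEq]
  simp [divLetter, divState, and_assoc]

theorem mem_turn_divAutomaton {n D : ℕ} {R : ℕ → Bool} {l : Bool} {t : ℕ} {s : DivState} :
    s ∈ divAutomaton.turn (divState n D R l t n) ↔
      l = false ∧ n.testBit t = false ∧ ∃ l' d, s = ⟨l', d, decide (D % 2 ^ (t + 1) ≠ 0),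
        decide (¬ 2 ^ (t + 1) ∣ sinceReset R n), false, d⟩ ∧ (l' → d = false) := by
  simp only [divAutomaton, Set.mem_ofPred_eq, divState, decide_not_two_pow_succ_dvd,
    decide_mod_two_pow_succ_ne_zero]

theorem mem_accept_divAutomaton {n D : ℕ} {R : ℕ → Bool} {l : Bool} {t : ℕ} :
    divState n D R l t n ∈ divAutomaton.accept ↔
      l ∧ D % 2 ^ t ≠ 0 ∧ ¬ 2 ^ (t + 1) ∣ sinceReset R n := by
  simp only [divAutomaton, Set.mem_ofPred_eq, divState, decide_not_two_pow_succ_dvd,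
    decide_eq_true_eq]

/-- The automaton in the sweep number `t` has guessed the digits of a number `D < 2 ^ (t + 1)`. -/
theorem exists_of_reaches_divAutomaton {n t h : ℕ} {s : DivState} {w : ℕ → DivLetter}
    (hr : divAutomaton.Reaches n t h s w) :
    ∃ D R l, s = divState n D R l t h ∧ (∀ i < n, w i = divWord D R t h i) ∧ D < 2 ^ (t + 1) ∧
      (l → D.testBit t = false) ∧ 2 ^ t ∣ n ∧ ResetsValid D R l t h := by
  induction hr with
  | @start s w hs hw =>
    obtain ⟨l, d, rfl, hl⟩ := hs
    -- The resets are fixed once and for all by the initial letters; of `D` only digit `0` is known.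
    refine ⟨d.toNat, fun i => (w i).reset, l, ?_, ?_, ?_, ?_, by simp, by simp [ResetsValid]⟩
    · cases d <;> simp [divState, sinceReset, Nat.mod_one]
    · intro i _
      have := hw i
      rcases hwi : w i with ⟨a, b, c⟩
      simp_all [divAutomaton, divWord, divLetter]
    · cases d <;> simp
    · cases d <;> simp_all
  | @step t h s w s' a hr hh hs ih =>
    obtain ⟨D, R, l, rfl, hw, hD, hl, hn, hR⟩ := ih
    rw [hw h hh] at hs
    obtain ⟨rfl, rfl, h1, h2⟩ := mem_step_divAutomaton.1 hs
    refine ⟨D, R, l, rfl, update_eq_divWord hw, hD, hl, hn, fun i hi => ?_⟩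
    rcases Nat.lt_succ_iff_lt_or_eq.1 hi with hi | rfl
    · exact hR i hi
    · exact ⟨h1, h2⟩
  | @turn t s w s' hr hs ih =>
    obtain ⟨D, R, l, rfl, hw, hD, hl, hn, hR⟩ := ih
    obtain ⟨rfl, hnt, l', d, rfl, hl'⟩ := mem_turn_divAutomaton.1 hs
    -- The new digit changes `D` by a multiple of `2 ^ (t + 1)`, and the stored letters depend only
    -- on `D` modulo `2 ^ (t + 1)`. The record of reset checks starts afresh: soundness needs only
    -- those of the last sweep.
    have hmod : (D + 2 ^ (t + 1) * d.toNat) % 2 ^ (t + 1) = D % 2 ^ (t + 1) := by simp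
    have hbit : (D + 2 ^ (t + 1) * d.toNat).testBit (t + 1) = d := by
      rw [Nat.testBit_add_of_two_pow_dvd D (Nat.dvd_mul_right _ _), Nat.testBit_lt_two_pow hD]
      cases d <;> simp
    refine ⟨D + 2 ^ (t + 1) * d.toNat, R, l', ?_, fun i hi => ?_, ?_, ?_, ?_,
      by simp [ResetsValid]⟩
    · simp only [divState, hmod, hbit, sinceReset, Nat.zero_testBit, add_zero]
    · rw [hw i hi]
      simp only [divWord, divLetter, hi, Nat.not_lt_zero, if_false, if_true, add_assoc _ _ 1,
        Nat.two_pow_dvd_add_iff_of_mod_eq _ hmod]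
    · rw [pow_succ _ (t + 1)]
      cases d <;> simp <;> omega
    · rwa [hbit]
    · exact (Nat.two_pow_succ_dvd_iff _ _).2 ⟨hn, hnt⟩

/-! ### Correctness of the automaton -/

theorem succ_mod_eq_ite (i m : ℕ) (hm : 0 < m) :
    (i + 1) % m = if m ∣ i + 1 then 0 else i % m + 1 := by
  split_ifs with h
  · exact Nat.mod_eq_zero_of_dvd h
  · have hlt := Nat.mod_lt i hm
    have hmod : (i + 1) % m = (i % m + 1) % m := (Nat.mod_add_mod i m 1).symm
    rcases (Nat.succ_le_of_lt hlt).lt_or_eq with h' | h'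
    · rw [hmod, Nat.mod_eq_of_lt h']
    · rw [Nat.dvd_iff_mod_eq_zero, hmod] at h
      exact absurd (by rw [show i % m + 1 = m from h', Nat.mod_self]) h

/-- The automaton's check of square `i` refers to the guessed counter, not to `i % m`; so the reset
condition is required only where the two already agree, which the induction supplies. -/
theorem sinceReset_eq_mod {m n : ℕ} (hm : 0 < m) {R : ℕ → Bool}
    (h : ∀ i < n, sinceReset R i = i % m → (R i ↔ i % m + 1 = m)) :
    ∀ i ≤ n, sinceReset R i = i % m := by
  intro i
  induction i with
  | zero => simp [sinceReset]
  | succ i ih =>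
    intro hi
    have hR := h i hi (ih (by omega))
    have hdvd : m ∣ i + 1 ↔ i % m + 1 = m := by
      have hlt := Nat.mod_lt i hm
      rw [Nat.dvd_iff_mod_eq_zero, ← Nat.mod_add_mod i m 1]
      constructor
      · intro h0
        by_contra hne
        rw [Nat.mod_eq_of_lt (by omega)] at h0
        omega
      · intro h1
        rw [h1, Nat.mod_self]
    rw [succ_mod_eq_ite i m hm, sinceReset, ih (by omega)]
    simp only [hR, hdvd]

/-- The sum lies between `1` and `2 ^ K`, so it is a multiple of `2 ^ K` only if equal to it. -/
theorem two_pow_dvd_add_mod_iff {K D m : ℕ} (hm : 0 < m) (hK : D + m = 2 ^ K) (i : ℕ) :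
    2 ^ K ∣ D + i % m + 1 ↔ i % m + 1 = m := by
  have hlt := Nat.mod_lt i hm
  constructor
  · intro h
    have := Nat.le_of_dvd (by omega) h
    omega
  · intro h
    rw [add_assoc, h, hK]

theorem exists_of_accepts_divAutomaton {n k : ℕ} (h : divAutomaton.Accepts n k) :
    ∃ m, 2 ^ k < m ∧ m < 2 ^ (k + 1) ∧ 2 ^ k ∣ n ∧ ¬ m ∣ n := by
  obtain ⟨s, w, hr, hs⟩ := h
  obtain ⟨D, R, l, rfl, -, hD, hl, hn, hR⟩ := exists_of_reaches_divAutomaton hr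
  obtain ⟨hl1, hD0, hrem⟩ := mem_accept_divAutomaton.1 hs
  -- The sweep flagged as last has digit `k` of `D` equal to zero. Together with `D ≠ 0` this places
  -- `2 ^ (k + 1) - D` strictly between `2 ^ k` and `2 ^ (k + 1)`.
  have hDk : D < 2 ^ k := by
    have h1 : (D / 2 ^ k) % 2 ≠ 1 := by
      simpa [Nat.testBit_eq_decide_div_mod_eq] using hl hl1
    have h2 : D / 2 ^ k < 2 := Nat.div_lt_of_lt_mul (by rwa [← pow_succ])
    have h3 : D / 2 ^ k = 0 := by
      generalize D / 2 ^ k = u at h1 h2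
      omega
    exact (Nat.div_eq_zero_iff_lt (by positivity)).1 h3
  rw [Nat.mod_eq_of_lt hDk] at hD0
  have hpow : 2 ^ (k + 1) = 2 ^ k * 2 := pow_succ 2 k
  have hm : 0 < 2 ^ (k + 1) - D := by omega
  have hDm : D + (2 ^ (k + 1) - D) = 2 ^ (k + 1) := by omega
  refine ⟨2 ^ (k + 1) - D, by omega, by omega, hn, fun hmn => hrem ?_⟩
  rw [sinceReset_eq_mod hm (fun i hi hmod => ?_) n le_rfl, Nat.mod_eq_zero_of_dvd hmn]
  · exact dvd_zero _
  · have h1 := hR i hi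
    rw [hmod, two_pow_dvd_add_mod_iff hm hDm] at h1
    exact ⟨h1.1, fun h => by_contra fun h' => h1.2 hl1 h' h⟩

theorem accepts_divAutomaton {n k m : ℕ} (hkm : 2 ^ k < m) (hmk : m < 2 ^ (k + 1))
    (hk : 2 ^ k ∣ n) (hmn : ¬ m ∣ n) : divAutomaton.Accepts n k := by
  have hpow : 2 ^ (k + 1) = 2 ^ k * 2 := pow_succ 2 k
  obtain ⟨D, hD⟩ : ∃ D, D + m = 2 ^ (k + 1) := ⟨2 ^ (k + 1) - m, by omega⟩
  have hDk : D < 2 ^ k := by omega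
  have hm : 0 < m := by omega
  set R : ℕ → Bool := fun i => decide (i % m + 1 = m) with hR
  have hmod : ∀ i, sinceReset R i = i % m := fun i =>
    sinceReset_eq_mod hm (fun i _ _ => by simp [hR]) i le_rfl
  have hdvd : ∀ i, R i ↔ 2 ^ (k + 1) ∣ D + sinceReset R i + 1 := fun i => by
    rw [hmod, two_pow_dvd_add_mod_iff hm hD]; simp [hR]
  have hbit : ∀ t, decide (t = k) → D.testBit t = false := fun t ht => by
    rw [of_decide_eq_true ht, Nat.testBit_lt_two_pow hDk]
  have sweep : ∀ t ≤ k, (∃ w, (∀ i < n, w i = divWord D R t 0 i) ∧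
      divAutomaton.Reaches n t 0 (divState n D R (decide (t = k)) t 0) w) → ∀ h ≤ n,
      ∃ w, (∀ i < n, w i = divWord D R t h i) ∧
        divAutomaton.Reaches n t h (divState n D R (decide (t = k)) t h) w := by
    intro t ht h0 h
    induction h with
    | zero => exact fun _ => h0
    | succ h ih =>
      intro hh
      obtain ⟨w, hw, hr⟩ := ih (by omega)
      refine ⟨_, update_eq_divWord hw, hr.step (by omega) ?_⟩
      rw [hw h (by omega)]
      -- At a reset every lower power of two divides as well. The converse is checked only in the
      -- last sweep, since squares without reset may have zeros in the low digits.
      refine mem_step_divAutomaton.2 ⟨rfl, rfl, fun h1 => ?_, fun h1 h2 h3 => ?_⟩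
      · exact (Nat.pow_dvd_pow 2 (by omega)).trans ((hdvd h).1 h1)
      · rw [of_decide_eq_true h1] at h3
        exact h2 ((hdvd h).2 h3)
  have key : ∀ t ≤ k, ∃ w, (∀ i < n, w i = divWord D R t 0 i) ∧
      divAutomaton.Reaches n t 0 (divState n D R (decide (t = k)) t 0) w := by
    intro t
    induction t with
    | zero =>
      intro _
      refine ⟨divWord D R 0 0, fun _ _ => rfl, .start ⟨decide (0 = k), D.testBit 0, ?_, hbit 0⟩
        fun i => ?_⟩
      · simp [divState, sinceReset, Nat.mod_one]
      · simp [divAutomaton, divWord, divLetter]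
    | succ t ih =>
      intro ht
      obtain ⟨w, hw, hr⟩ := sweep t (by omega) (ih (by omega)) n le_rfl
      refine ⟨w, fun i hi => ?_, hr.turn (mem_turn_divAutomaton.2 ⟨?_, ?_,
        decide (t + 1 = k), D.testBit (t + 1), ?_, hbit _⟩)⟩
      · rw [hw i hi]
        simp [divWord, hi]
      · exact decide_eq_false (by omega)
      · exact ((Nat.two_pow_succ_dvd_iff n t).1 ((Nat.pow_dvd_pow 2 ht).trans hk)).2
      · simp only [divState, sinceReset, Nat.zero_testBit, add_zero]
  obtain ⟨w, -, hr⟩ := sweep k le_rfl (key k le_rfl) n le_rfl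
  refine ⟨_, w, hr, ?_⟩
  rw [mem_accept_divAutomaton, hmod, Nat.mod_eq_of_lt hDk]
  -- As `n % m < m < 2 ^ (k + 1)`, divisibility by `2 ^ (k + 1)` forces `n % m = 0`.
  refine ⟨by simp, by omega, fun h => hmn ?_⟩
  have hlt := Nat.mod_lt n hm
  rw [Nat.dvd_iff_mod_eq_zero]
  exact Nat.eq_zero_of_dvd_of_lt h (by omega)

theorem language_divAutomaton_toTM : divAutomaton.toTM.language = LAMᶜ := by
  ext x
  rw [SweepAutomaton.mem_language_toTM]
  constructor
  · rintro (h | ⟨k, h⟩)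
    · rintro ⟨q, ⟨⟨_, hq⟩, -⟩, -⟩
      exact hq (by rw [h]; exact dvd_zero q)
    · obtain ⟨m, h1, h2, h3, h4⟩ := exists_of_accepts_divAutomaton h
      exact notMem_LAM_of_dvd h1 h2 h3 h4
  · intro h
    refine or_iff_not_imp_left.2 fun h0 => ?_
    obtain ⟨k, m, h1, h2, h3, h4⟩ := exists_of_notMem_LAM h h0
    exact ⟨k, accepts_divAutomaton h1 h2 (h3 _ (by positivity) le_rfl) h4⟩

/-! ### Resource bounds -/

theorem one_le_logb_logb {n : ℕ} (hn : 4 ≤ n) : 1 ≤ Real.logb 2 (Real.logb 2 n) := by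
  have hn' : (4 : ℝ) ≤ n := by exact_mod_cast hn
  have h1 : (2 : ℝ) ≤ Real.logb 2 n := by
    rw [Real.le_logb_iff_rpow_le (by norm_num) (by linarith)]
    norm_num
    exact hn
  rw [Real.le_logb_iff_rpow_le (by norm_num) (by linarith)]
  simpa using h1

theorem natCast_le_logb_logb {n j : ℕ} (h : 2 ^ 2 ^ j ≤ n) :
    (j : ℝ) ≤ Real.logb 2 (Real.logb 2 n) := by
  have hn : ((2 : ℝ) ^ (2 ^ j : ℕ)) ≤ n := by exact_mod_cast h
  have hn0 : (0 : ℝ) < n := lt_of_lt_of_le (by positivity) hn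
  have h1 : ((2 : ℝ) ^ j) ≤ Real.logb 2 n := by
    rw [Real.le_logb_iff_rpow_le (by norm_num) hn0]
    refine le_trans (le_of_eq ?_) hn
    rw [← Real.rpow_natCast 2 (2 ^ j)]
    push_cast
    rfl
  rw [Real.le_logb_iff_rpow_le (by norm_num) (lt_of_lt_of_le (by positivity) h1),
    Real.rpow_natCast]
  exact h1

theorem exists_isAcceptingComputation_divAutomaton {x : List Unit} (hx : 4 ≤ x.length)
    (hmem : x ∈ divAutomaton.toTM.language) :
    ∃ C, divAutomaton.toTM.IsAcceptingComputation x C ∧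
      (OffLineTM.time C : ℝ) ≤
        11 * (x.length * Real.logb 2 (Real.logb 2 (x.length : ℝ))) ∧
      (OffLineTM.crossing C : ℝ) ≤ 7 * Real.logb 2 (Real.logb 2 (x.length : ℝ)) := by
  rw [language_divAutomaton_toTM] at hmem
  have h0 : x.length ≠ 0 := by omega
  obtain ⟨k, m, h1, h2, h3, h4⟩ := exists_of_notMem_LAM hmem h0
  obtain ⟨C, hC, hT, hX⟩ :=
    (accepts_divAutomaton h1 h2 (h3 _ (by positivity) le_rfl) h4).exists_isAcceptingComputation h0
  -- No `m` satisfies `1 < m < 2`. With `k = j + 1` the size estimate yields `j ≤ log log n`.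
  have hk : k ≠ 0 := by
    rintro rfl
    norm_num at h1 h2
    omega
  obtain ⟨j, rfl⟩ := Nat.exists_eq_succ_of_ne_zero hk
  have hj := natCast_le_logb_logb (Nat.two_pow_two_pow_le h0 h3)
  have hl := one_le_logb_logb hx
  refine ⟨C, hC, ?_, ?_⟩
  · rw [hT]
    have hn : (4 : ℝ) ≤ x.length := by exact_mod_cast hx
    push_cast
    generalize Real.logb 2 (Real.logb 2 (x.length : ℝ)) = l at hj hl ⊢
    generalize (x.length : ℝ) = n at hn ⊢
    -- The `j + 2` round trips contribute `9 * n * l`; the final sweep and the accepting move add at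
    -- most `n * l` each, whence the constant `11`.
    have e1 : (2 * n + 1) * ((j : ℝ) + 1 + 1) ≤ (3 * n) * (3 * l) := by
      apply mul_le_mul <;> first | positivity | linarith
    have e2 : n ≤ n * l := le_mul_of_one_le_right (by linarith) hl
    have e3 : 1 ≤ n * l := by linarith
    linarith
  · have : (OffLineTM.crossing C : ℝ) ≤ 2 * (j + 1 + 1) + 1 := by exact_mod_cast hX
    linarith

/-- One cheap accepting computation per accepted input bounds the minimum; on other inputs the value
is `sInf ∅ = 0`, which is where `0 ≤ B` enters. -/
theorem OffLineTM.weak_le {σ Γ Q : Type} [Fintype σ] {M : OffLineTM σ Γ Q}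
    {r : List (OffLineTM.Cfg Γ Q) → ℕ} {n : ℕ} {B : ℝ} (hB : 0 ≤ B)
    (h : ∀ x ∈ M.language, x.length = n → ∃ C, M.IsAcceptingComputation x C ∧ (r C : ℝ) ≤ B) :
    (M.weak r n : ℝ) ≤ B := by
  rw [← Nat.le_floor_iff hB]
  refine Finset.sup_le fun f _ => ?_
  rw [Nat.le_floor_iff hB, weakOn]
  by_cases hx : List.ofFn f ∈ M.language
  · obtain ⟨C, hC, hle⟩ := h _ hx (by simp)
    exact le_trans (Nat.cast_le.2 (Nat.sInf_le ⟨C, hC, rfl⟩)) hle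
  · have : {k | ∃ C, M.IsAcceptingComputation (List.ofFn f) C ∧ r C = k} = ∅ := by
      ext k
      simp only [Set.mem_ofPred_eq, Set.mem_empty_iff_false, iff_false]
      rintro ⟨C, hC, -⟩
      exact hx ⟨C, hC⟩
    simpa [this] using hB

theorem theorem8 :
    (∃ (Γ Q : Type) (_ : Finite Γ) (_ : Finite Q) (M : OffLineTM Unit Γ Q),
      M.language = LAMᶜ ∧
      (fun n : ℕ => (M.weak OffLineTM.time n : ℝ)) =O[Filter.atTop]
        (fun n : ℕ => (n : ℝ) * Real.logb 2 (Real.logb 2 (n : ℝ))) ∧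
      (fun n : ℕ => (M.weak OffLineTM.crossing n : ℝ)) =O[Filter.atTop]
        (fun n : ℕ => Real.logb 2 (Real.logb 2 (n : ℝ)))) ∧
    ¬ (LAMᶜ).IsRegular := by
  refine ⟨⟨_, _, inferInstance, inferInstance, divAutomaton.toTM, language_divAutomaton_toTM,
    .of_bound 11 ?_, .of_bound 7 ?_⟩, not_isRegular_LAM_compl⟩ <;>
  -- From `n = 4` on, `log log n ≥ 1`, so additive constants are absorbed.
  · filter_upwards [Filter.eventually_ge_atTop 4] with n hn
    have hl := one_le_logb_logb hn
    have hl0 : 0 ≤ Real.logb 2 (Real.logb 2 (n : ℝ)) := by linarith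
    rw [Real.norm_of_nonneg (Nat.cast_nonneg _), Real.norm_of_nonneg (by positivity)]
    refine OffLineTM.weak_le (by positivity) fun x hx hlen => ?_
    subst hlen
    obtain ⟨C, hC, hT, hX⟩ := exists_isAcceptingComputation_divAutomaton hn hx
    exact ⟨C, hC, by assumption⟩
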